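/- Consider the many-sorted signature of Diffie--Hellman structures without the box function. Its sorts are $G$ (group elements), $E$ (exponents) and $NZE$ (nonzero exponents), with $NZE$ a subsort of $E$. Its operations are $\cdot : G\times G\to G$, $\mathrm{id} : G$, $\mathrm{inv} : G\to G$, $\exp : G\times E\to G$ (written $a^e$), $+, * : E\times E\to E$, $0 : E$, $- : E\to E$, $1 : NZE$, $i : NZE\to NZE$ and $** : NZE\times NZE\to NZE$. For a field $F$, let $\mathcal M_F$ be the structure of this signature in which $G$ and $E$ are interpreted as $F$ and $NZE$ as $F\setminus\{0\}$; the operations $+,0,-,*,1$ are those of $F$, $**$ is the multiplication and $i$ the multiplicative inverse of nonzero elements; the group operation $\cdot$ is $+$, so that $\mathrm{id}=0$ and $\mathrm{inv}(a)=-a$; and $a^e$ is interpreted as the product $a*e$. Write $\mathcal M_F\models s=t$ if the terms $s$ and $t$ have the same value in $\mathcal M_F$ under every sort-respecting assignment of values to the variables. For a prime $q$, let $\mathbb F_q$ be the field with $q$ elements. Let $s$ and $t$ be terms of the same sort over this signature, with variables of any of the sorts. If $\mathcal M_{\mathbb F_q}\models s=t$ for infinitely many primes $q$, then $\mathcal M_{\mathbb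 F_q}\models s=t$ for every prime $q$. -/

import Mathlib

namespace DiffieHellman

/-- The sorts: base-group elements, exponents, and nonzero exponents (a subsort of the exponents). -/
inductive DHSort
  | G
  | E
  | NZE

/-- Well-sorted terms of the box-free signature over a sorted family `V` of variables.
The constructor `coe` renders the subsort inclusion of `NZE` in `E`. -/
inductive Term (V : DHSort → Type*) : DHSort → Type _
  | var {σ : DHSort} (x : V σ) : Term V σ
  | gop (a b : Term V .G) : Term V .G
  | gid : Term V .G
  | ginv (a : Term V .G) : Term V .G
  | exp (a : Term V .G) (e : Term V .E) : Term V .G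
  | zero : Term V .E
  | neg (e : Term V .E) : Term V .E
  | add (e f : Term V .E) : Term V .E
  | mul (e f : Term V .E) : Term V .E
  | coe (u : Term V .NZE) : Term V .E
  | one : Term V .NZE
  | inv (u : Term V .NZE) : Term V .NZE
  | nzmul (u v : Term V .NZE) : Term V .NZE

/-- Box-free models of the theory of Diffie-Hellman structures: `G` is an abelian group, `E` a
commutative unitary ring with a subset `NZE` that carries multiplication and multiplicative
inverses, and exponentiation makes `G` a unitary right `E`-module. -/
structure Model.{u} where
  G : Type u
  E : Type u
  NZE : Set E
  gop : G → G → G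
  gid : G
  ginv : G → G
  exp : G → E → G
  zero : E
  neg : E → E
  add : E → E → E
  mul : E → E → E
  one : NZE
  inv : NZE → NZE
  nzmul : NZE → NZE → NZE
  gop_assoc : ∀ a b c, gop (gop a b) c = gop a (gop b c)
  gop_comm : ∀ a b, gop a b = gop b a
  gop_gid : ∀ b, gop b gid = b
  gop_ginv : ∀ b, gop b (ginv b) = gid
  add_assoc : ∀ x y z, add (add x y) z = add x (add y z)
  add_comm : ∀ x y, add x y = add y x
  add_zero : ∀ x, add x zero = x
  add_neg : ∀ x, add x (neg x) = zero
  mul_assoc : ∀ x y z, mul (mul x y) z = mul x (mul y z)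
  mul_comm : ∀ x y, mul x y = mul y x
  mul_add : ∀ x y z, mul x (add y z) = add (mul x y) (mul x z)
  mul_one : ∀ x, mul x one = x
  nzmul_eq : ∀ u v : NZE, (nzmul u v : E) = mul u v
  mul_inv : ∀ u : NZE, mul (u : E) (inv u) = one
  inv_nzmul : ∀ u v, inv (nzmul u v) = nzmul (inv u) (inv v)
  inv_one : inv one = one
  inv_inv : ∀ w, inv (inv w) = w
  exp_exp : ∀ a x y, exp (exp a x) y = exp a (mul x y)
  exp_one : ∀ a, exp a one = a
  gop_exp : ∀ a b x, exp (gop a b) x = gop (exp a x) (exp b x)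
  exp_add : ∀ a x y, exp a (add x y) = gop (exp a x) (exp a y)
  gid_exp : ∀ x, exp gid x = gid

/-- The carrier of each sort of a model. -/
def Model.Carrier.{u} (M : Model.{u}) : DHSort → Type u
  | .G => M.G
  | .E => M.E
  | .NZE => M.NZE

/-- The value of a term in a model under an environment. -/
def Term.eval {V : DHSort → Type*} (M : Model) (η : ∀ σ, V σ → M.Carrier σ) :
    {σ : DHSort} → Term V σ → M.Carrier σ
  | σ, .var x => η σ x
  | _, .gop a b => M.gop (a.eval M η) (b.eval M η)
  | _, .gid => M.gid
  | _, .ginv a => M.ginv (a.eval M η)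
  | _, .exp a e => M.exp (a.eval M η) (e.eval M η)
  | _, .zero => M.zero
  | _, .neg e => M.neg (e.eval M η)
  | _, .add e f => M.add (e.eval M η) (f.eval M η)
  | _, .mul e f => M.mul (e.eval M η) (f.eval M η)
  | _, .coe u => (show M.NZE from u.eval M η).1
  | _, .one => M.one
  | _, .inv u => M.inv (u.eval M η)
  | _, .nzmul u v => M.nzmul (u.eval M η) (v.eval M η)

/-- The equation `s = t` is valid in `M`, that is, true under every environment. -/
def Model.Satisfies {V : DHSort → Type*} (M : Model) {σ : DHSort} (s t : Term V σ) : Prop :=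
  ∀ η : ∀ σ, V σ → M.Carrier σ, s.eval M η = t.eval M η

/-- The box-free model determined by a field `F`: both `G` and `E` are `F`, `NZE` is the set of
nonzero elements, the group operation is addition and exponentiation is multiplication. -/
def fieldModel (F : Type*) [Field F] : Model where
  G := F
  E := F
  NZE := {x | x ≠ 0}
  gop a b := a + b
  gid := 0
  ginv a := -a
  exp a e := a * e
  zero := 0
  neg e := -e
  add e f := e + f
  mul e f := e * f
  one := ⟨1, one_ne_zero⟩
  inv u := ⟨u.1⁻¹, inv_ne_zero u.2⟩
  nzmul u v := ⟨u.1 * v.1, mul_ne_zero u.2 v.2⟩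
  gop_assoc := add_assoc
  gop_comm := add_comm
  gop_gid := add_zero
  gop_ginv := add_neg_cancel
  add_assoc := add_assoc
  add_comm := add_comm
  add_zero := add_zero
  add_neg := add_neg_cancel
  mul_assoc := mul_assoc
  mul_comm := mul_comm
  mul_add := mul_add
  mul_one := mul_one
  nzmul_eq _ _ := rfl
  mul_inv u := mul_inv_cancel₀ u.2
  inv_nzmul u v := Subtype.ext (mul_inv u.1 v.1)
  inv_one := Subtype.ext inv_one
  inv_inv w := Subtype.ext (inv_inv w.1)
  exp_exp := mul_assoc
  exp_one := mul_one
  gop_exp := add_mul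
  exp_add := mul_add
  gid_exp := zero_mul

end DiffieHellman

/-!
The only inverses a term can form are inverses of terms of sort `NZE`, which never vanish in a
field. Hence every term is, uniformly in the field, a quotient of two integer polynomials in its
variables whose denominator never vanishes (`Term.exists_fraction`), and an equation `s = t` amounts
to the vanishing of one integer polynomial `p` at all environments
(`Term.exists_polynomial_satisfies_iff`). If `p ≠ 0`, multiply `p` by the product of its variables
and choose an integer point at which the result takes a value `n ≠ 0`. Modulo a prime that does not
divide `n`, this point has nonzero coordinates at the variables of `p`, so it is a legitimate
environment, and it refutes `s = t`. An equation valid in `𝔽_q` for infinitely many `q` therefore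
has `p = 0`, which makes it valid in every field.
-/

namespace DiffieHellman

/-- An element of a carrier of `fieldModel F`, read as an element of `F`. -/
def fieldValue {F : Type*} [Field F] : {σ : DHSort} → (fieldModel F).Carrier σ → F
  | .G => fun x => x
  | .E => fun x => x
  | .NZE => fun x => x.1

/-- An environment in `fieldModel F` as a single family of elements of `F`, indexed by the
variables of all sorts together. -/
def flatten {V : DHSort → Type*} {F : Type*} [Field F]
    (η : ∀ σ, V σ → (fieldModel F).Carrier σ) (v : Σ σ, V σ) : F :=
  fieldValue (η v.1 v.2)

theorem fieldValue_injective {F : Type*} [Field F] {σ : DHSort} :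
    Function.Injective (fieldValue : (fieldModel F).Carrier σ → F) := by
  cases σ
  · exact fun _ _ h => h
  · exact fun _ _ h => h
  · exact fun _ _ h => Subtype.ext h

theorem fieldValue_ne_zero {F : Type*} [Field F] (x : (fieldModel F).Carrier .NZE) :
    fieldValue x ≠ 0 := x.2

/-- The element of a carrier of `fieldModel F` given by `x`, where the value `0`, which is not
available in the sort `NZE`, is replaced by `1`. -/
noncomputable def ofField {F : Type*} [Field F] (x : F) : (σ : DHSort) → (fieldModel F).Carrier σ
  | .G => x
  | .E => x
  | .NZE => by
      classical exact if h : x ≠ 0 then ⟨x, h⟩ else (fieldModel F).one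

theorem fieldValue_ofField {F : Type*} [Field F] {x : F} (hx : x ≠ 0) (σ : DHSort) :
    fieldValue (ofField x σ) = x := by
  cases σ
  · rfl
  · rfl
  · exact congrArg fieldValue (dif_pos hx)

open MvPolynomial in
/-- Every term is a quotient of two integer polynomials, the same in every field, and the
denominator vanishes at no environment. -/
theorem Term.exists_fraction {V : DHSort → Type*} {σ : DHSort} (s : Term V σ) :
    ∃ p d : MvPolynomial (Σ σ, V σ) ℤ, ∀ (F : Type) [Field F]
      (η : ∀ σ, V σ → (fieldModel F).Carrier σ),
      aeval (flatten η) d ≠ 0 ∧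
        fieldValue (s.eval (fieldModel F) η) * aeval (flatten η) d = aeval (flatten η) p := by
  induction s with
  | @var τ x =>
    refine ⟨X ⟨τ, x⟩, 1, fun F _ η => ⟨by simp, ?_⟩⟩
    rw [map_one, aeval_X, _root_.mul_one]
    rfl
  | gop a b iha ihb | add a b iha ihb =>
    obtain ⟨p, d, h⟩ := iha
    obtain ⟨p', d', h'⟩ := ihb
    refine ⟨p * d' + p' * d, d * d', fun F _ η => ?_⟩
    obtain ⟨hd, hp⟩ := h F η
    obtain ⟨hd', hp'⟩ := h' F η
    refine ⟨by simp [hd, hd'], ?_⟩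
    rw [map_add, map_mul, map_mul, map_mul, ← hp, ← hp']
    change (fieldValue (a.eval _ η) + fieldValue (b.eval _ η)) * _ = _
    ring
  | exp a b iha ihb | mul a b iha ihb | nzmul a b iha ihb =>
    obtain ⟨p, d, h⟩ := iha
    obtain ⟨p', d', h'⟩ := ihb
    refine ⟨p * p', d * d', fun F _ η => ?_⟩
    obtain ⟨hd, hp⟩ := h F η
    obtain ⟨hd', hp'⟩ := h' F η
    refine ⟨by simp [hd, hd'], ?_⟩
    rw [map_mul, map_mul, ← hp, ← hp']
    change (fieldValue (a.eval _ η) * fieldValue (b.eval _ η)) * _ = _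
    ring
  | gid | zero =>
    refine ⟨0, 1, fun F _ η => ⟨by simp, ?_⟩⟩
    rw [map_zero]
    exact zero_mul _
  | one =>
    refine ⟨1, 1, fun F _ η => ⟨by simp, ?_⟩⟩
    rw [map_one]
    exact _root_.mul_one _
  | ginv a ih | neg a ih =>
    obtain ⟨p, d, h⟩ := ih
    refine ⟨-p, d, fun F _ η => ⟨(h F η).1, ?_⟩⟩
    rw [map_neg, ← (h F η).2]
    exact neg_mul _ _
  | coe a ih =>
    obtain ⟨p, d, h⟩ := ih
    exact ⟨p, d, h⟩
  | inv a ih =>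
    obtain ⟨p, d, h⟩ := ih
    refine ⟨d, p, fun F _ η => ?_⟩
    obtain ⟨hd, hp⟩ := h F η
    have ha := fieldValue_ne_zero (a.eval (fieldModel F) η)
    rw [← hp]
    exact ⟨mul_ne_zero ha hd, inv_mul_cancel_left₀ ha _⟩

open MvPolynomial in
/-- Validity of an equation in the models of fields is the vanishing of one integer polynomial at
all environments. -/
theorem Term.exists_polynomial_satisfies_iff {V : DHSort → Type*} {σ : DHSort} (s t : Term V σ) :
    ∃ p : MvPolynomial (Σ σ, V σ) ℤ, ∀ (F : Type) [Field F],
      (fieldModel F).Satisfies s t ↔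
        ∀ η : ∀ σ, V σ → (fieldModel F).Carrier σ, aeval (flatten η) p = 0 := by
  obtain ⟨p, d, h⟩ := s.exists_fraction
  obtain ⟨p', d', h'⟩ := t.exists_fraction
  refine ⟨p * d' - p' * d, fun F _ => forall_congr' fun η => ?_⟩
  obtain ⟨hd, hp⟩ := h F η
  obtain ⟨hd', hp'⟩ := h' F η
  rw [← fieldValue_injective.eq_iff, map_sub, map_mul, map_mul, ← hp, ← hp', sub_eq_zero,
    mul_right_comm, mul_left_inj' hd, mul_left_inj' hd']

open MvPolynomial in
/-- The primes `q` for which a nonzero integer polynomial vanishes at all environments in `ZMod q`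
all divide a single nonzero integer; in particular, there are only finitely many of them. -/
theorem exists_int_forall_not_dvd_exists_aeval_ne_zero {V : DHSort → Type*}
    {p : MvPolynomial (Σ σ, V σ) ℤ}
    (hp : p ≠ 0) :
    ∃ n : ℤ, n ≠ 0 ∧ ∀ (q : ℕ) [Fact q.Prime], ¬ (q : ℤ) ∣ n →
      ∃ η : ∀ σ, V σ → (fieldModel (ZMod q)).Carrier σ, aeval (flatten η) p ≠ 0 := by
  have hprod : (∏ v ∈ p.vars, X v) * p ≠ 0 :=
    mul_ne_zero (Finset.prod_ne_zero_iff.2 fun v _ => X_ne_zero v) hp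
  obtain ⟨x, hx⟩ : ∃ x, eval x ((∏ v ∈ p.vars, X v) * p) ≠ 0 := by
    by_contra! hx
    exact hprod (MvPolynomial.funext fun x => by rw [hx, map_zero])
  refine ⟨_, hx, fun q _ hq => ⟨fun σ v => ofField (x ⟨σ, v⟩ : ZMod q) σ, ?_⟩⟩
  rw [← ZMod.intCast_zmod_eq_zero_iff_dvd, map_mul, map_prod, Int.cast_mul, Int.cast_prod,
    mul_eq_zero, not_or, Finset.prod_eq_zero_iff] at hq
  obtain ⟨hvars, hpx⟩ := hq
  simp only [eval_X, not_exists, not_and] at hvars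
  have hcast : aeval (fun v => (x v : ZMod q)) p = ((eval x p : ℤ) : ZMod q) := by
    rw [← eq_intCast (Int.castRingHom (ZMod q)), ← coe_aeval_eq_eval]
    exact (map_aeval x (Int.castRingHom (ZMod q)) p).symm
  rw [← hcast] at hpx
  -- The environment agrees with the integer point at the variables of `p`, where it is nonzero.
  convert hpx using 1
  refine eval₂Hom_congr' rfl (fun v hv _ => ?_) rfl
  exact fieldValue_ofField (hvars v hv) v.1

end DiffieHellman

theorem mainTheorem2 {V : DiffieHellman.DHSort → Type*} {σ : DiffieHellman.DHSort}
    (s t : DiffieHellman.Term V σ)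
    (h : {q : Nat.Primes | haveI : Fact (q : ℕ).Prime := ⟨q.2⟩
      (DiffieHellman.fieldModel (ZMod q)).Satisfies s t}.Infinite) :
    ∀ q : Nat.Primes, haveI : Fact (q : ℕ).Prime := ⟨q.2⟩
      (DiffieHellman.fieldModel (ZMod q)).Satisfies s t := by
  obtain ⟨p, hiff⟩ := s.exists_polynomial_satisfies_iff t
  have hp : p = 0 := by
    by_contra hp
    obtain ⟨n, hn, hη⟩ := DiffieHellman.exists_int_forall_not_dvd_exists_aeval_ne_zero hp
    refine h (Set.Finite.subset (s := {q : Nat.Primes | (q : ℕ) ∈ n.natAbs.divisors})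
      ((Finset.finite_toSet _).preimage Nat.Primes.coe_nat_injective.injOn) fun q hq => ?_)
    have : Fact (q : ℕ).Prime := ⟨q.2⟩
    by_contra hdvd
    obtain ⟨η, hne⟩ := hη q fun hqn =>
      hdvd (Nat.mem_divisors.2 ⟨Int.natCast_dvd.1 hqn, Int.natAbs_ne_zero.2 hn⟩)
    exact hne ((hiff (ZMod q)).1 hq η)
  intro q
  have : Fact (q : ℕ).Prime := ⟨q.2⟩
  exact (hiff (ZMod q)).2 fun η => by rw [hp, map_zero]
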